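/- Let $d$ be an odd prime and let $n\ge 0$. Let $\mathcal H=\mathbb C^d$ with computational basis $\{|k\rangle\}_{k\in\mathbb Z_d}$, let $\chi(k)=e^{2\pi i k/d}$, $X|k\rangle=|k+1\rangle$, $Z|k\rangle=\chi(k)|k\rangle$, and define the Pauli operators on $\mathcal H^{\otimes n}$ by $w(\vec p,\vec q)=\bigotimes_{i=1}^n \chi(-2^{-1}p_iq_i)Z^{p_i}X^{q_i}$ for $\vec p,\vec q\in\mathbb Z_d^n$, with $2^{-1}$ taken in $\mathbb Z_d$. A pure stabilizer state is a unit vector in $\mathcal H^{\otimes n}$ that is a common eigenvector of an abelian group, of size $d^n$, consisting of operators $w(\vec p,\vec q)$; let $\mathrm{STAB}$ be the set of these states. The Hadamard convolution of operators $\rho,\sigma$ on $\mathcal H^{\otimes n}$ is $$\rho\boxtimes_H\sigma=\mathrm{Tr}_B\big[V_H(\rho\otimes\sigma)V_H^\dagger\big],\qquad V_H=U_H^{\otimes n},\qquad U_H=\sum_{x,y\in\mathbb Z_d}|x\rangle\langle x+y|\otimes|y\rangle\langle x-y|,$$ where the $i$-th copy of $U_H$ acts on the $i$-th qudits of the first and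 of the second system, and $\mathrm{Tr}_B$ is the partial trace over the second system. For a unit vector $\psi\in\mathcal H^{\otimes n}$ (writing $\psi$ also for $|\psi\rangle\langle\psi|$), let $\mathrm{Pr}_{\mathrm{accep}}[\psi]$ be the probability that the swap test on two copies of $\psi\boxtimes_H\psi$ outputs $0$. (The swap test on $\rho\otimes\sigma$ prepares an ancilla qubit in $|0\rangle$, applies a Hadamard gate to the ancilla, a swap of the two systems controlled by the ancilla, and again a Hadamard gate to the ancilla, and then measures the ancilla in the computational basis.) There is an absolute constant $C$, independent of $d$, $n$ and $\psi$, such that for every odd prime $d$, every $n$ and every unit vector $\psi\in\mathcal H^{\otimes n}$: the maximum $\max_{\phi\in\mathrm{STAB}}|\langle\psi|\phi\rangle|^2$ is attained, $$\mathrm{Pr}_{\mathrm{accep}}[\psi]=\tfrac12\big[1+\mathrm{Tr}\big((\psi\boxtimes_H\psi)^2\big)\big],$$ and, writing $\max_{\phi\in\mathrm{STAB}}|\langle\psi|\phi\rangle|^2=1-\epsilon$, $$\tfrac12\big[1+(1-\epsilon)^4\big]\le \mathrm{Pr}_{\mathrm{accep}}[\psi]\le 1-2\epsilon+C\epsilon^2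 .$$ -/

import Mathlib

open scoped Kronecker Matrix

noncomputable section

namespace StabTest

/-- Labels of the computational basis of `n` qudits of local dimension `d`. -/
abbrev Idx (d n : ℕ) : Type := Fin n → ZMod d

/-- Operators on `n` qudits, as matrices in the computational basis. -/
abbrev Op (d n : ℕ) : Type := Matrix (Idx d n) (Idx d n) ℂ

/-- Vectors of the `n`-qudit Hilbert space `(ℂ^d)^{⊗ n}`, in the computational basis. -/
abbrev Ket (d n : ℕ) [NeZero d] : Type := EuclideanSpace ℂ (Idx d n)

/-- The character `χ(k) = exp(2πik/d)` of `ℤ/d`. -/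
def chi {d : ℕ} [NeZero d] (k : ZMod d) : ℂ := ZMod.stdAddChar k

/-- The shift operator, `X |k⟩ = |k+1⟩`. -/
def pauliX (d : ℕ) : Matrix (ZMod d) (ZMod d) ℂ :=
  Matrix.of fun i k => if i = k + 1 then 1 else 0

/-- The clock operator, `Z |k⟩ = χ(k) |k⟩`. -/
def pauliZ (d : ℕ) [NeZero d] : Matrix (ZMod d) (ZMod d) ℂ :=
  Matrix.diagonal chi

/-- The one-qudit Pauli (Weyl) operator `w(p,q) = χ(-2⁻¹pq) Z^p X^q`, with `2⁻¹` taken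
in `ℤ/d` (`d` odd). -/
def weyl₁ {d : ℕ} [NeZero d] (p q : ZMod d) : Matrix (ZMod d) (ZMod d) ℂ :=
  chi (-(2⁻¹ * p * q)) • (pauliZ d ^ p.val * pauliX d ^ q.val)

/-- The `n`-qudit Pauli operator `w(p,q) = w(p₁,q₁) ⊗ ⋯ ⊗ w(pₙ,qₙ)`. -/
def weyl {d n : ℕ} [NeZero d] (p q : Fin n → ZMod d) : Op d n :=
  Matrix.of fun x y => ∏ i, weyl₁ (p i) (q i) (x i) (y i)

/-- A pure stabilizer state: a unit vector which is a common eigenvector of some abelian group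
of Pauli operators of size `d ^ n`. Only the operators `w(p,q)` themselves, without additional
phases, are Pauli operators here. -/
def IsStabilizerState {d n : ℕ} [NeZero d] (φ : Ket d n) : Prop :=
  ‖φ‖ = 1 ∧
  ∃ S : Subgroup (Op d n)ˣ,
    (∀ g ∈ S, ∃ p q : Fin n → ZMod d, (g : Op d n) = weyl p q) ∧
    (∀ g ∈ S, ∀ h ∈ S, g * h = h * g) ∧
    Nat.card S = d ^ n ∧
    ∀ g ∈ S, ∃ c : ℂ, (g : Op d n) *ᵥ φ.ofLp = c • φ.ofLp

/-- The set of overlaps `|⟨ψ|φ⟩|²` of `ψ` with the pure stabilizer states `φ`. -/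
def stabilizerOverlaps {d n : ℕ} [NeZero d] (ψ : Ket d n) : Set ℝ :=
  {F | ∃ φ : Ket d n, IsStabilizerState φ ∧ F = ‖inner ℂ ψ φ‖ ^ 2}

/-- The maximal stabilizer fidelity of `ψ`. -/
def stabilizerFidelity {d n : ℕ} [NeZero d] (ψ : Ket d n) : ℝ :=
  sSup (stabilizerOverlaps ψ)

/-- The rank-one operator `|ψ⟩⟨ψ|`. -/
def proj {d n : ℕ} [NeZero d] (ψ : Ket d n) : Op d n :=
  Matrix.vecMulVec ψ.ofLp (star ψ.ofLp)

/-- The two-qudit unitary `U_H = ∑_{x,y} |x⟩⟨x+y| ⊗ |y⟩⟨x-y|`. -/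
def hadamardU (d : ℕ) [NeZero d] : Matrix (ZMod d × ZMod d) (ZMod d × ZMod d) ℂ :=
  ∑ x : ZMod d, ∑ y : ZMod d,
    Matrix.single x (x + y) (1 : ℂ) ⊗ₖ Matrix.single y (x - y) (1 : ℂ)

/-- `V_H = U_H^{⊗ n}`, the `i`-th factor acting on the `i`-th qudit of the first system and the
`i`-th qudit of the second system. -/
def hadamardV (d n : ℕ) [NeZero d] : Matrix (Idx d n × Idx d n) (Idx d n × Idx d n) ℂ :=
  Matrix.of fun a b => ∏ i, hadamardU d (a.1 i, a.2 i) (b.1 i, b.2 i)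

/-- The partial trace over the second tensor factor. -/
def partialTraceB {A B : Type*} [Fintype B] (M : Matrix (A × B) (A × B) ℂ) : Matrix A A ℂ :=
  Matrix.of fun i j => ∑ k, M (i, k) (j, k)

/-- The Hadamard convolution `ρ ⊠_H σ = Tr_B [V_H (ρ ⊗ σ) V_H†]`. -/
def hadamardConv {d n : ℕ} [NeZero d] (ρ σ : Op d n) : Op d n :=
  partialTraceB (hadamardV d n * (ρ ⊗ₖ σ) * (hadamardV d n)ᴴ)

/-- The Hadamard gate on the ancilla qubit. -/
def ancillaH : Matrix (Fin 2) (Fin 2) ℂ :=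
  ((Real.sqrt 2 : ℝ) : ℂ)⁻¹ • !![1, 1; 1, -1]

/-- The swap operator `|x⟩|y⟩ ↦ |y⟩|x⟩`. -/
def swapOp (A : Type*) [DecidableEq A] : Matrix (A × A) (A × A) ℂ :=
  Matrix.of fun a b => if a = b.swap then 1 else 0

/-- The swap operator controlled by the ancilla qubit,
`|0⟩⟨0| ⊗ I + |1⟩⟨1| ⊗ SWAP`. -/
def controlledSwap (A : Type*) [DecidableEq A] :
    Matrix (Fin 2 × (A × A)) (Fin 2 × (A × A)) ℂ :=
  Matrix.single 0 0 (1 : ℂ) ⊗ₖ (1 : Matrix (A × A) (A × A) ℂ)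
    + Matrix.single 1 1 (1 : ℂ) ⊗ₖ swapOp A

/-- The circuit of the swap test: Hadamard gate on the ancilla, controlled swap, Hadamard gate
on the ancilla. -/
def swapTestCircuit (A : Type*) [Fintype A] [DecidableEq A] :
    Matrix (Fin 2 × (A × A)) (Fin 2 × (A × A)) ℂ :=
  (ancillaH ⊗ₖ (1 : Matrix (A × A) (A × A) ℂ)) * controlledSwap A *
    (ancillaH ⊗ₖ (1 : Matrix (A × A) (A × A) ℂ))

/-- The probability that the swap test on `ρ ⊗ σ`, with the ancilla prepared in `|0⟩⟨0|`,
outputs `0` when the ancilla is measured in the computational basis. -/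
def swapTestProb {A : Type*} [Fintype A] [DecidableEq A] (ρ σ : Matrix A A ℂ) : ℝ :=
  (Matrix.trace ((Matrix.single 0 0 (1 : ℂ) ⊗ₖ (1 : Matrix (A × A) (A × A) ℂ)) *
    (swapTestCircuit A * (Matrix.single 0 0 (1 : ℂ) ⊗ₖ (ρ ⊗ₖ σ)) *
      (swapTestCircuit A)ᴴ))).re

/-- The acceptance probability of the stabilizer test: from four copies of `ψ`, form two copies
of `ψ ⊠_H ψ`, perform the swap test on them, and accept on output `0`. -/
def acceptProb {d n : ℕ} [NeZero d] (ψ : Ket d n) : ℝ :=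
  swapTestProb (hadamardConv (proj ψ) (proj ψ)) (hadamardConv (proj ψ) (proj ψ))

end StabTest

end

/-!
For an operator `A` let `Ξ_A(u) = Tr (A w(u))` be its characteristic function on phase space
`ℤ_d^n × ℤ_d^n`. Two facts about it carry the argument. Plancherel's identity
`∑ᵤ Ξ_A(u) conj Ξ_B(u) = d^n Tr (A B†)` (`sum_charFn_mul_star`) expresses purities and transition
probabilities through `Ξ`. Since `V_H†(w(p,q) ⊗ I)V_H = w(p/2,q) ⊗ w(p/2,q)`, the Hadamard
convolution multiplies characteristic functions (`charFn_hadamardConv`). Hence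
`Tr ((ψ ⊠_H ψ)²) = d⁻ⁿ ∑ᵤ |Ξ_ψ(u)|⁴` (`trace_hadamardConv_sq`), and the swap test turns this into
the acceptance probability.

Let `φ` be a stabilizer state and `L` the set of `u` for which `φ` is an eigenvector of `w(u)`. Then
`|Ξ_φ| = 1` on `L` and `|L| ≥ d^n`, whereas `∑ᵤ |Ξ_φ(u)|² = d^n` by Plancherel; so `|L| = d^n` and
`Ξ_φ` vanishes off `L` (`card_stabilizerLabels`). In particular `F = |⟨ψ|φ⟩|²` is the average of
`Ξ_ψ conj Ξ_φ` over `L` (`sum_stabilizerLabels`). No group structure of `L` is needed.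

The lower bound `F⁴ ≤ d⁻ⁿ ∑ᵤ |Ξ_ψ(u)|⁴` is the power mean inequality on `L`. For the upper bound,
write `ψ = aφ + η` with `η ⊥ φ`, so that `‖η‖² = 1 - F = ε`. On `L` one has
`Ξ_ψ conj Ξ_φ = F + g` with `|g| ≤ ε` and `g` of mean zero, so the average of `|Ξ_ψ|⁴` is
`F⁴ + O(ε²)`. Off `L` one has `|Ξ_ψ|² ≤ 9ε`, while the power mean inequality on `L` leaves a weight
`∑ |Ξ_ψ|² ≤ (1 - F²) d^n ≤ 2ε d^n` there, so the contribution is again `O(ε²)`. Together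
(`sum_norm_charFn_pow_four_le`), `d⁻ⁿ ∑ᵤ |Ξ_ψ(u)|⁴ ≤ (1 - ε)⁴ + O(ε²) = 1 - 4ε + O(ε²)`.

The maximal overlap is attained because the stabilizer states form a nonempty compact set: only
finitely many groups occur, and for unit vectors the eigenvector condition is closed.
-/

namespace StabTest

/-! ### Characters and Weyl operators -/

section Weyl

variable {d n : ℕ} [NeZero d]

lemma chi_zero : chi (0 : ZMod d) = 1 := AddChar.map_zero_eq_one _

lemma chi_add (a b : ZMod d) : chi (a + b) = chi a * chi b := AddChar.map_add_eq_mul _ _ _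

lemma norm_chi (a : ZMod d) : ‖chi a‖ = 1 := AddChar.norm_apply _ _

lemma star_chi (a : ZMod d) : star (chi a) = chi (-a) :=
  (AddChar.map_neg_eq_conj _ _).symm

lemma chi_sum {ι : Type*} (s : Finset ι) (f : ι → ZMod d) :
    chi (∑ i ∈ s, f i) = ∏ i ∈ s, chi (f i) := by
  classical
  induction s using Finset.induction_on with
  | empty => simp [chi_zero]
  | insert a s ha ih => rw [Finset.sum_insert ha, Finset.prod_insert ha, chi_add, ih]

lemma sum_chi_dotProduct (x : Idx d n) :
    ∑ p : Idx d n, chi (p ⬝ᵥ x) = if x = 0 then (d : ℂ) ^ n else 0 := by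
  have h1 : ∀ b : ZMod d, ∑ k : ZMod d, chi (k * b) = if b = 0 then (d : ℂ) else 0 := by
    intro b
    have := AddChar.sum_mulShift b (ZMod.isPrimitive_stdAddChar d)
    simpa [chi, ZMod.card] using this
  have h2 : ∑ p : Idx d n, chi (p ⬝ᵥ x) = ∏ i, ∑ k : ZMod d, chi (k * x i) := by
    rw [Finset.prod_univ_sum, Fintype.piFinset_univ]
    simp [dotProduct, chi_sum]
  rw [h2]
  simp only [h1]
  split_ifs with hx
  · simp [hx]
  · obtain ⟨i, hi⟩ := Function.ne_iff.mp hx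
    exact Finset.prod_eq_zero (Finset.mem_univ i) (if_neg hi)

lemma pauliX_pow_apply (k : ℕ) (i j : ZMod d) :
    (pauliX d ^ k) i j = if i = j + k then 1 else 0 := by
  induction k generalizing i j with
  | zero => simp [Matrix.one_apply]
  | succ k ih =>
    have hX : ∀ b, pauliX d b j = if b = j + 1 then 1 else 0 := fun _ => rfl
    rw [pow_succ, Matrix.mul_apply]
    simp only [ih, hX, mul_ite, mul_one, mul_zero]
    rw [Finset.sum_eq_single (j + 1)]
    · push_cast
      rw [if_pos rfl, add_assoc, add_comm (1 : ZMod d)]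
    · intro b _ hb
      simp [hb]
    · simp

lemma weyl₁_apply (p q x y : ZMod d) :
    weyl₁ p q x y = if x = y + q then chi (-(2⁻¹ * p * q) + p * x) else 0 := by
  have hpow : chi x ^ p.val = chi (p * x) := by
    rw [chi, chi, ← AddChar.map_nsmul_eq_pow, nsmul_eq_mul, ZMod.natCast_zmod_val]
  simp only [weyl₁, pauliZ, Matrix.diagonal_pow, Matrix.smul_apply, Matrix.diagonal_mul,
    pauliX_pow_apply, Pi.pow_apply, smul_eq_mul, ZMod.natCast_zmod_val]
  split_ifs
  · rw [hpow, mul_one, chi_add]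
  · simp

lemma weyl_apply (p q x y : Idx d n) :
    weyl p q x y = if x = y + q then chi (-(2⁻¹ * (p ⬝ᵥ q)) + p ⬝ᵥ x) else 0 := by
  simp only [weyl, Matrix.of_apply, weyl₁_apply]
  split_ifs with h
  · have hi : ∀ i, x i = y i + q i := congrFun h
    rw [Finset.prod_congr rfl fun i _ => if_pos (hi i), ← chi_sum]
    congr 1
    simp [dotProduct, Finset.sum_add_distrib, Finset.mul_sum, mul_assoc]
  · obtain ⟨i, hi⟩ := Function.ne_iff.mp h
    exact Finset.prod_eq_zero (Finset.mem_univ i) (if_neg (by simpa using hi))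

lemma weyl_zero_right (p : Idx d n) :
    weyl p 0 = Matrix.diagonal fun x => chi (p ⬝ᵥ x) := by
  ext x y
  simp only [weyl_apply, Matrix.diagonal_apply, add_zero, dotProduct_zero, mul_zero, neg_zero,
    zero_add]

lemma weyl_mulVec_add (p q : Idx d n) (v : Idx d n → ℂ) (x : Idx d n) :
    (weyl p q *ᵥ v) (x + q) = chi (-(2⁻¹ * (p ⬝ᵥ q)) + p ⬝ᵥ (x + q)) * v x := by
  simp only [Matrix.mulVec, dotProduct, weyl_apply, add_left_inj, ite_mul, zero_mul]
  rw [Finset.sum_ite_eq]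
  simp

/-- The Weyl operator `w(p,q)` acting on kets. -/
noncomputable def weylMap (p q : Idx d n) : Ket d n →ₗ[ℂ] Ket d n :=
  Matrix.toEuclideanLin (weyl p q)

lemma weylMap_ofLp (p q : Idx d n) (ψ : Ket d n) :
    (weylMap p q ψ).ofLp = weyl p q *ᵥ ψ.ofLp := rfl

lemma weylMap_zero (ψ : Ket d n) : weylMap 0 0 ψ = ψ := by
  apply WithLp.ofLp_injective
  rw [weylMap_ofLp, weyl_zero_right]
  simp [chi_zero]

lemma inner_weylMap_weylMap (p q : Idx d n) (φ ψ : Ket d n) :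
    inner ℂ (weylMap p q φ) (weylMap p q ψ) = inner ℂ φ ψ := by
  simp only [PiLp.inner_apply, RCLike.inner_apply, weylMap_ofLp]
  rw [← Equiv.sum_comp (Equiv.addRight q)]
  refine Finset.sum_congr rfl fun x _ => ?_
  simp only [Equiv.coe_addRight, weyl_mulVec_add, map_mul]
  have h := Complex.mul_conj' (chi (-(2⁻¹ * (p ⬝ᵥ q)) + p ⬝ᵥ (x + q)))
  rw [norm_chi] at h
  calc _ = (chi (-(2⁻¹ * (p ⬝ᵥ q)) + p ⬝ᵥ (x + q)) *
        (starRingEnd ℂ) (chi (-(2⁻¹ * (p ⬝ᵥ q)) + p ⬝ᵥ (x + q)))) *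
        (ψ.ofLp x * (starRingEnd ℂ) (φ.ofLp x)) := by ring
    _ = _ := by rw [h]; simp

lemma norm_weylMap (p q : Idx d n) (ψ : Ket d n) : ‖weylMap p q ψ‖ = ‖ψ‖ := by
  rw [@norm_eq_sqrt_re_inner ℂ, @norm_eq_sqrt_re_inner ℂ _ _ _ _ ψ, inner_weylMap_weylMap]

/-! ### The characteristic function and Plancherel's identity -/

/-- The characteristic function `u ↦ Tr (A w(u))` of an operator, on phase space
`ℤ_d^n × ℤ_d^n`. -/
noncomputable def charFn (A : Op d n) (u : Idx d n × Idx d n) : ℂ :=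
  Matrix.trace (A * weyl u.1 u.2)

lemma charFn_eq_sum (A : Op d n) (u : Idx d n × Idx d n) :
    charFn A u = chi (-(2⁻¹ * (u.1 ⬝ᵥ u.2)) + u.1 ⬝ᵥ u.2) *
      ∑ x, A x (x + u.2) * chi (u.1 ⬝ᵥ x) := by
  simp only [charFn, Matrix.trace, Matrix.diag, Matrix.mul_apply, weyl_apply, mul_ite, mul_zero,
    Finset.sum_ite_eq', Finset.mem_univ, if_true, dotProduct_add, chi_add, Finset.mul_sum]
  refine Finset.sum_congr rfl fun x _ => ?_
  ring

lemma charFn_zero (A : Op d n) : charFn A 0 = Matrix.trace A := by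
  simp [charFn, weyl_zero_right, chi_zero]

/-- Plancherel's identity: the Weyl operators are an orthogonal basis for the trace form. -/
lemma sum_charFn_mul_star (A B : Op d n) :
    ∑ u, charFn A u * star (charFn B u) = (d : ℂ) ^ n * Matrix.trace (A * Bᴴ) := by
  have key : ∀ q : Idx d n, ∑ p, charFn A (p, q) * star (charFn B (p, q)) =
      (d : ℂ) ^ n * ∑ x, A x (x + q) * star (B x (x + q)) := by
    intro q
    have h1 : ∀ p : Idx d n, charFn A (p, q) * star (charFn B (p, q)) =
        ∑ x, ∑ y, A x (x + q) * star (B y (y + q)) * chi (p ⬝ᵥ (x - y)) := by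
      intro p
      have h := Complex.mul_conj' (chi (-(2⁻¹ * (p ⬝ᵥ q)) + p ⬝ᵥ q))
      rw [norm_chi] at h
      simp only [charFn_eq_sum, star_mul', star_sum]
      rw [mul_mul_mul_comm, Complex.star_def, h, Finset.sum_mul_sum]
      rw [Complex.ofReal_one, one_pow, one_mul]
      refine Finset.sum_congr rfl fun x _ => Finset.sum_congr rfl fun y _ => ?_
      rw [dotProduct_sub, sub_eq_add_neg, chi_add, ← star_chi, Complex.star_def]
      ring
    simp only [h1]
    rw [Finset.sum_comm, Finset.mul_sum]
    refine Finset.sum_congr rfl fun x _ => ?_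
    rw [Finset.sum_comm]
    simp only [← Finset.mul_sum, sum_chi_dotProduct, sub_eq_zero, mul_ite, mul_zero,
      Finset.sum_ite_eq, Finset.mem_univ, if_true]
    ring
  rw [Fintype.sum_prod_type_right]
  simp only [key, ← Finset.mul_sum]
  rw [Finset.sum_comm]
  congr 1
  simp only [Matrix.trace, Matrix.diag, Matrix.mul_apply, Matrix.conjTranspose_apply]
  refine Finset.sum_congr rfl fun x _ => ?_
  exact Equiv.sum_comp (Equiv.addLeft x) fun y => A x y * star (B x y)

lemma charFn_proj (ψ : Ket d n) (u : Idx d n × Idx d n) :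
    charFn (proj ψ) u = inner ℂ ψ (weylMap u.1 u.2 ψ) := by
  rw [charFn, proj, Matrix.trace_mul_comm, Matrix.mul_vecMulVec, Matrix.trace_vecMulVec,
    EuclideanSpace.inner_eq_star_dotProduct, weylMap_ofLp]

lemma norm_charFn_proj_le (ψ : Ket d n) (u : Idx d n × Idx d n) :
    ‖charFn (proj ψ) u‖ ≤ ‖ψ‖ ^ 2 := by
  rw [charFn_proj, sq]
  exact (norm_inner_le_norm _ _).trans_eq (by rw [norm_weylMap])

lemma conjTranspose_proj (ψ : Ket d n) : (proj ψ)ᴴ = proj ψ := by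
  simp [proj, Matrix.conjTranspose_vecMulVec]

lemma trace_proj_mul_proj (ψ φ : Ket d n) :
    Matrix.trace (proj ψ * proj φ) = ((‖inner ℂ ψ φ‖ ^ 2 : ℝ) : ℂ) := by
  rw [proj, proj, Matrix.vecMulVec_mul_vecMulVec, Matrix.trace_vecMulVec, dotProduct_smul]
  have h1 : star ψ.ofLp ⬝ᵥ φ.ofLp = inner ℂ ψ φ := by
    rw [EuclideanSpace.inner_eq_star_dotProduct, dotProduct_comm]
  have h2 : ψ.ofLp ⬝ᵥ star φ.ofLp = star (inner ℂ ψ φ) := by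
    rw [Complex.star_def, inner_conj_symm, EuclideanSpace.inner_eq_star_dotProduct]
  rw [h1, h2, smul_eq_mul, Complex.star_def, Complex.mul_conj']
  push_cast
  rfl

/-- Transition probabilities are the correlations of characteristic functions. -/
lemma sum_charFn_proj_mul_star (ψ φ : Ket d n) :
    ∑ u, charFn (proj ψ) u * star (charFn (proj φ) u) =
      ((d ^ n * ‖inner ℂ ψ φ‖ ^ 2 : ℝ) : ℂ) := by
  rw [sum_charFn_mul_star, conjTranspose_proj, trace_proj_mul_proj]
  push_cast
  rfl

lemma sum_norm_charFn_sq {ψ : Ket d n} (hψ : ‖ψ‖ = 1) :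
    ∑ u, ‖charFn (proj ψ) u‖ ^ 2 = (d : ℝ) ^ n := by
  have h := sum_charFn_proj_mul_star ψ ψ
  simp only [Complex.star_def, Complex.mul_conj'] at h
  have h' : ‖inner ℂ ψ ψ‖ = 1 := by rw [inner_self_eq_norm_sq_to_K, hψ]; simp
  rw [h'] at h
  have := congrArg Complex.re h
  norm_cast at this
  simpa using this

end Weyl

/-! ### The swap test -/

section SwapTest

variable {A : Type*} [Fintype A] [DecidableEq A]

lemma trace_swapOp_mul_kronecker (ρ σ : Matrix A A ℂ) :
    Matrix.trace (swapOp A * (ρ ⊗ₖ σ)) = Matrix.trace (ρ * σ) := by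
  have h : ∀ x : A × A, (swapOp A * (ρ ⊗ₖ σ)) x x = ρ x.2 x.1 * σ x.1 x.2 := by
    rintro ⟨x, y⟩
    rw [Matrix.mul_apply, Finset.sum_eq_single (y, x)]
    · simp [swapOp]
    · rintro ⟨a, b⟩ _ hb
      have hne : ¬ (x, y) = Prod.swap (a, b) := by
        intro h
        apply hb
        simp only [Prod.swap_prod_mk, Prod.mk.injEq] at h
        rw [h.1, h.2]
      rw [swapOp, Matrix.of_apply, if_neg hne, zero_mul]
    · simp
  simp only [Matrix.trace, Matrix.diag, h, Matrix.mul_apply]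
  rw [Fintype.sum_prod_type_right]

/-- The block `⟨0|·|0⟩` of the swap test circuit is `(I + SWAP)/2`, so the probability of
output `0` is read off from `Tr ρ Tr σ` and `Tr (SWAP (ρ ⊗ σ)) = Tr (ρσ)`. -/
lemma swapTestProb_eq (ρ σ : Matrix A A ℂ) :
    swapTestProb ρ σ =
      (1 / 2 * (Matrix.trace ρ * Matrix.trace σ + Matrix.trace (ρ * σ))).re := by
  have hs : (swapOp A)ᴴ = swapOp A := by
    ext a b
    simp only [swapOp, Matrix.conjTranspose_apply, Matrix.of_apply, apply_ite star, star_one,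
      star_zero]
    congr 1
    rw [eq_iff_iff]
    exact ⟨fun h => by rw [h, Prod.swap_swap], fun h => by rw [h, Prod.swap_swap]⟩
  have hss : swapOp A * swapOp A = 1 := by
    ext a b
    simp only [swapOp, Matrix.mul_apply, Matrix.of_apply, Matrix.one_apply, mul_ite, mul_one,
      mul_zero, Finset.sum_ite_eq', Finset.mem_univ, if_true, Prod.swap_swap]
  have h2 : ((Real.sqrt 2 : ℝ) : ℂ)⁻¹ * ((Real.sqrt 2 : ℝ) : ℂ)⁻¹ = 1 / 2 := by
    rw [← mul_inv, ← Complex.ofReal_mul, Real.mul_self_sqrt (by norm_num)]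
    norm_num
  have hP : (Matrix.single 0 0 1 : Matrix (Fin 2) (Fin 2) ℂ) = !![1, 0; 0, 0] ∧
      (Matrix.single 1 1 1 : Matrix (Fin 2) (Fin 2) ℂ) = !![0, 0; 0, 1] := by
    constructor <;>
    · ext i j
      fin_cases i <;> fin_cases j <;> simp
  have h0 : ancillaH * Matrix.single 0 0 1 * ancillaH = (1 / 2 : ℂ) • !![1, 1; 1, 1] := by
    ext i j
    fin_cases i <;> fin_cases j <;>
      simp [ancillaH, hP, h2]
  have h1 : ancillaH * Matrix.single 1 1 1 * ancillaH = (1 / 2 : ℂ) • !![1, -1; -1, 1] := by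
    ext i j
    fin_cases i <;> fin_cases j <;>
      simp [ancillaH, hP, h2]
  have hC : swapTestCircuit A = ((1 / 2 : ℂ) • !![1, 1; 1, 1]) ⊗ₖ (1 : Matrix (A × A) (A × A) ℂ) +
      ((1 / 2 : ℂ) • !![1, -1; -1, 1]) ⊗ₖ swapOp A := by
    simp only [swapTestCircuit, controlledSwap, mul_add, add_mul, ← Matrix.mul_kronecker_mul,
      h0, h1, one_mul, mul_one]
  have hC' : (swapTestCircuit A)ᴴ =
      ((1 / 2 : ℂ) • !![1, 1; 1, 1]) ⊗ₖ (1 : Matrix (A × A) (A × A) ℂ) +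
      ((1 / 2 : ℂ) • !![1, -1; -1, 1]) ⊗ₖ swapOp A := by
    rw [hC, Matrix.conjTranspose_add, Matrix.conjTranspose_kronecker,
      Matrix.conjTranspose_kronecker, hs, Matrix.conjTranspose_one]
    congr 2 <;>
    · ext i j
      fin_cases i <;> fin_cases j <;> simp
  have hτ : Matrix.trace (swapOp A * (ρ ⊗ₖ σ) * swapOp A) = Matrix.trace ρ * Matrix.trace σ := by
    rw [Matrix.trace_mul_comm, ← mul_assoc, hss, one_mul, Matrix.trace_kronecker]
  have hτ' : Matrix.trace ((ρ ⊗ₖ σ) * swapOp A) = Matrix.trace (ρ * σ) := by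
    rw [Matrix.trace_mul_comm, trace_swapOp_mul_kronecker]
  rw [swapTestProb, hC', hC]
  simp only [mul_add, add_mul, ← Matrix.mul_kronecker_mul, Matrix.trace_add,
    Matrix.trace_kronecker (m := Fin 2), one_mul, mul_one, hτ, hτ', trace_swapOp_mul_kronecker,
    Matrix.trace_kronecker ρ σ]
  congr 1
  simp [hP, Matrix.trace, Fin.sum_univ_two]
  ring

end SwapTest

/-! ### The Hadamard convolution -/

section Convolution

variable {d n : ℕ}

lemma two_mul_inv_two [Fact d.Prime] (hd : Odd d) : (2 : ZMod d) * 2⁻¹ = 1 := by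
  have h : ((2 : ℕ) : ZMod d) * ((2 : ℕ) : ZMod d)⁻¹ = 1 :=
    ZMod.coe_mul_inv_eq_one 2 (Nat.coprime_two_left.mpr hd)
  simpa using h

lemma hadamardV_apply [NeZero d] (a b : Idx d n × Idx d n) :
    hadamardV d n a b = if b = (a.1 + a.2, a.1 - a.2) then 1 else 0 := by
  have h1 : ∀ a b : ZMod d × ZMod d,
      hadamardU d a b = if b = (a.1 + a.2, a.1 - a.2) then 1 else 0 := by
    rintro ⟨x, y⟩ ⟨x', y'⟩
    simp only [hadamardU, Matrix.sum_apply, Matrix.kronecker_apply, Matrix.single_apply]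
    rw [Finset.sum_eq_single x, Finset.sum_eq_single y]
    · simp only [Prod.mk.injEq, true_and, ← ite_and, mul_ite, mul_one, mul_zero]
      simp only [eq_comm, and_comm]
    · intro b _ hb; simp [hb]
    · simp
    · intro b _ hb; simp [hb]
    · simp
  simp only [hadamardV, Matrix.of_apply, h1]
  split_ifs with h
  · subst h
    simp
  · have : ∃ i, ¬ ((b.1 i, b.2 i) = (a.1 i + a.2 i, a.1 i - a.2 i)) := by
      by_contra! hc
      apply h
      ext i
      · exact (Prod.ext_iff.mp (hc i)).1
      · exact (Prod.ext_iff.mp (hc i)).2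
    obtain ⟨i, hi⟩ := this
    exact Finset.prod_eq_zero (Finset.mem_univ i) (if_neg hi)

lemma hadamardConv_apply [NeZero d] (ρ σ : Op d n) (x y : Idx d n) :
    hadamardConv ρ σ x y = ∑ k, ρ (x + k) (y + k) * σ (x - k) (y - k) := by
  simp [hadamardConv, partialTraceB, Matrix.mul_apply, hadamardV_apply]

lemma conjTranspose_hadamardConv [NeZero d] (ρ σ : Op d n) :
    (hadamardConv ρ σ)ᴴ = hadamardConv ρᴴ σᴴ := by
  ext x y
  simp [hadamardConv_apply]

/-- The change of variables `(x, k) ↦ (x + k, x - k)`, invertible as `d` is odd. -/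
noncomputable def sumDiffEquiv [Fact d.Prime] (hd : Odd d) :
    Idx d n × Idx d n ≃ Idx d n × Idx d n where
  toFun a := (a.1 + a.2, a.1 - a.2)
  invFun b := ((2⁻¹ : ZMod d) • (b.1 + b.2), (2⁻¹ : ZMod d) • (b.1 - b.2))
  left_inv a := by
    have h := two_mul_inv_two hd
    ext i
    · simp only [Pi.smul_apply, Pi.add_apply, Pi.sub_apply, smul_eq_mul]
      linear_combination (a.1 i) * h
    · simp only [Pi.smul_apply, Pi.add_apply, Pi.sub_apply, smul_eq_mul]
      linear_combination (a.2 i) * h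
  right_inv b := by
    have h := two_mul_inv_two hd
    ext i
    · simp only [Pi.smul_apply, Pi.add_apply, Pi.sub_apply, smul_eq_mul]
      linear_combination (b.1 i) * h
    · simp only [Pi.smul_apply, Pi.add_apply, Pi.sub_apply, smul_eq_mul]
      linear_combination (b.2 i) * h

/-- Convolution becomes multiplication of characteristic functions, up to rescaling the
momentum variable by `2⁻¹`. -/
lemma charFn_hadamardConv [Fact d.Prime] (hd : Odd d) (ρ σ : Op d n) (p q : Idx d n) :
    charFn (hadamardConv ρ σ) (p, q) =
      charFn ρ ((2⁻¹ : ZMod d) • p, q) * charFn σ ((2⁻¹ : ZMod d) • p, q) := by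
  have h := two_mul_inv_two hd
  have h2 : ∀ x : ZMod d, (2⁻¹ : ZMod d) * x + 2⁻¹ * x = x := fun x => by
    linear_combination x * h
  simp only [charFn_eq_sum, smul_dotProduct, smul_eq_mul]
  rw [mul_mul_mul_comm, ← chi_add, Finset.sum_mul_sum, ← Fintype.sum_prod_type',
    ← Equiv.sum_comp (sumDiffEquiv hd), Fintype.sum_prod_type]
  congr 1
  · congr 1
    linear_combination (2⁻¹ - 1) * (p ⬝ᵥ q) * h
  · refine Finset.sum_congr rfl fun x _ => ?_
    rw [hadamardConv_apply, Finset.sum_mul]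
    refine Finset.sum_congr rfl fun k _ => ?_
    simp only [sumDiffEquiv, Equiv.coe_fn_mk]
    rw [mul_mul_mul_comm, ← chi_add, ← mul_add, ← dotProduct_add]
    have hk : x + q - k = x - k + q := by abel
    have hk' : x + q + k = x + k + q := by abel
    rw [hk, hk']
    congr 2
    · have hx : x + k + (x - k) = x + x := by abel
      rw [hx, dotProduct_add, mul_add, h2]

lemma trace_hadamardConv [Fact d.Prime] (hd : Odd d) (ρ σ : Op d n) :
    Matrix.trace (hadamardConv ρ σ) = Matrix.trace ρ * Matrix.trace σ := by
  have h := charFn_hadamardConv hd ρ σ 0 0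
  rw [smul_zero] at h
  rwa [← Prod.zero_eq_mk, charFn_zero, charFn_zero, charFn_zero] at h

/-- The purity of `ψ ⊠_H ψ` is the normalized fourth moment of the characteristic function
of `ψ`. -/
lemma trace_hadamardConv_sq [Fact d.Prime] (hd : Odd d) (ψ : Ket d n) :
    Matrix.trace (hadamardConv (proj ψ) (proj ψ) ^ 2) =
      (((d ^ n : ℝ)⁻¹ * ∑ u, ‖charFn (proj ψ) u‖ ^ 4 : ℝ) : ℂ) := by
  have hdn : (d : ℂ) ^ n ≠ 0 := pow_ne_zero _ (Nat.cast_ne_zero.mpr (NeZero.ne d))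
  have h := sum_charFn_mul_star (hadamardConv (proj ψ) (proj ψ)) (hadamardConv (proj ψ) (proj ψ))
  rw [conjTranspose_hadamardConv, conjTranspose_proj, ← sq] at h
  have hu : IsUnit (2⁻¹ : ZMod d) :=
    IsUnit.of_mul_eq_one _ ((mul_comm _ _).trans (two_mul_inv_two hd))
  have h3 : ∑ u, charFn (hadamardConv (proj ψ) (proj ψ)) u *
      star (charFn (hadamardConv (proj ψ) (proj ψ)) u) =
      ((∑ u, ‖charFn (proj ψ) u‖ ^ 4 : ℝ) : ℂ) := by
    rw [Fintype.sum_prod_type, Fintype.sum_prod_type,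
      ← Equiv.sum_comp (MulAction.toPerm hu.unit) (fun p => ∑ q, ‖charFn (proj ψ) (p, q)‖ ^ 4)]
    push_cast
    refine Finset.sum_congr rfl fun p _ => Finset.sum_congr rfl fun q _ => ?_
    rw [Complex.star_def, Complex.mul_conj', charFn_hadamardConv hd, norm_mul]
    simp only [MulAction.toPerm_apply, Units.smul_def, IsUnit.unit_spec]
    push_cast
    ring
  rw [h3] at h
  rw [Complex.ofReal_mul, h]
  push_cast
  field_simp

lemma acceptProb_eq [Fact d.Prime] (hd : Odd d) {ψ : Ket d n} (hψ : ‖ψ‖ = 1) :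
    acceptProb ψ = 1 / 2 * (1 + (d ^ n : ℝ)⁻¹ * ∑ u, ‖charFn (proj ψ) u‖ ^ 4) := by
  have ht : Matrix.trace (proj ψ) = 1 := by
    rw [← charFn_zero, charFn_proj]
    simp only [Prod.fst_zero, Prod.snd_zero]
    rw [weylMap_zero, inner_self_eq_norm_sq_to_K, hψ]
    simp
  rw [acceptProb, swapTestProb_eq, trace_hadamardConv hd, ht, ← sq (hadamardConv _ _),
    trace_hadamardConv_sq hd]
  have h : (1 / 2 * (1 * 1 * (1 * 1) + (((d ^ n : ℝ)⁻¹ * ∑ u, ‖charFn (proj ψ) u‖ ^ 4 : ℝ) : ℂ))) =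
      ((1 / 2 * (1 + (d ^ n : ℝ)⁻¹ * ∑ u, ‖charFn (proj ψ) u‖ ^ 4) : ℝ) : ℂ) := by
    push_cast
    ring
  rw [h, Complex.ofReal_re]

end Convolution

/-! ### Stabilizer states -/

section Stabilizer

variable {d n : ℕ} [NeZero d]

/-- The phase-space points `u` for which `φ` is an eigenvector of `w(u)`. For a stabilizer state
this is the Lagrangian subspace attached to it. -/
noncomputable def stabilizerLabels (φ : Ket d n) : Finset (Idx d n × Idx d n) :=
  (Set.toFinite {u | ∃ c : ℂ, weylMap u.1 u.2 φ = c • φ}).toFinset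

lemma mem_stabilizerLabels {φ : Ket d n} {u : Idx d n × Idx d n} :
    u ∈ stabilizerLabels φ ↔ ∃ c : ℂ, weylMap u.1 u.2 φ = c • φ := by
  simp [stabilizerLabels]

lemma weylMap_eq_charFn_smul {φ : Ket d n} (hφ : ‖φ‖ = 1) {u : Idx d n × Idx d n}
    (hu : u ∈ stabilizerLabels φ) :
    weylMap u.1 u.2 φ = charFn (proj φ) u • φ := by
  obtain ⟨c, hc⟩ := mem_stabilizerLabels.mp hu
  rw [charFn_proj, hc, inner_smul_right, inner_self_eq_norm_sq_to_K, hφ]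
  simp

lemma norm_charFn_of_mem {φ : Ket d n} (hφ : ‖φ‖ = 1) {u : Idx d n × Idx d n}
    (hu : u ∈ stabilizerLabels φ) : ‖charFn (proj φ) u‖ = 1 := by
  have h := congrArg norm (weylMap_eq_charFn_smul hφ hu)
  rwa [norm_weylMap, norm_smul, hφ, mul_one, eq_comm] at h

lemma le_card_stabilizerLabels {φ : Ket d n} (h : IsStabilizerState φ) :
    d ^ n ≤ (stabilizerLabels φ).card := by
  obtain ⟨-, S, hS, -, hcard, heig⟩ := h
  have hlab : ∀ g : S, ∃ u ∈ stabilizerLabels φ, (g.1 : Op d n) = weyl u.1 u.2 := by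
    rintro ⟨g, hg⟩
    obtain ⟨p, q, hpq⟩ := hS g hg
    obtain ⟨c, hc⟩ := heig g hg
    refine ⟨(p, q), mem_stabilizerLabels.mpr ⟨c, ?_⟩, hpq⟩
    rw [hpq] at hc
    exact WithLp.ofLp_injective _ hc
  choose u hu hgu using hlab
  have hinj : Function.Injective fun g : S => (⟨u g, hu g⟩ : stabilizerLabels φ) := by
    intro g h hgh
    have huu : u g = u h := congrArg Subtype.val hgh
    apply Subtype.ext
    apply Units.ext
    rw [hgu g, hgu h, huu]
  rw [← hcard]
  simpa using Nat.card_le_card_of_injective _ hinj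

/-- The labels of a stabilizer state already saturate Plancherel's identity
`∑ᵤ |Ξ_φ(u)|² = d^n`, which fixes their number and leaves no room off them. -/
lemma card_stabilizerLabels {φ : Ket d n} (h : IsStabilizerState φ) :
    (stabilizerLabels φ).card = d ^ n ∧ ∀ u ∉ stabilizerLabels φ, charFn (proj φ) u = 0 := by
  have hsum := sum_norm_charFn_sq h.1
  rw [← Finset.sum_add_sum_compl (stabilizerLabels φ),
    Finset.sum_congr rfl fun u hu => by rw [norm_charFn_of_mem h.1 hu]] at hsum
  have hle : ((d ^ n : ℕ) : ℝ) ≤ (stabilizerLabels φ).card :=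
    Nat.cast_le.mpr (le_card_stabilizerLabels h)
  have hnn : 0 ≤ ∑ u ∈ (stabilizerLabels φ)ᶜ, ‖charFn (proj φ) u‖ ^ 2 :=
    Finset.sum_nonneg fun _ _ => by positivity
  simp only [one_pow, Finset.sum_const, nsmul_eq_mul, mul_one] at hsum
  push_cast at hle
  refine ⟨?_, fun u hu => ?_⟩
  · have : ((stabilizerLabels φ).card : ℝ) = ((d ^ n : ℕ) : ℝ) := by push_cast; linarith
    exact_mod_cast this
  · have h0 : ∑ u ∈ (stabilizerLabels φ)ᶜ, ‖charFn (proj φ) u‖ ^ 2 = 0 := by linarith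
    rw [Finset.sum_eq_zero_iff_of_nonneg fun _ _ => by positivity] at h0
    simpa using h0 u (Finset.mem_compl.mpr hu)

/-- The fidelity with `φ` is an average over the labels of `φ` alone. -/
lemma sum_stabilizerLabels {φ : Ket d n} (h : IsStabilizerState φ) (ψ : Ket d n) :
    ∑ u ∈ stabilizerLabels φ, charFn (proj ψ) u * star (charFn (proj φ) u) =
      ((d ^ n * ‖inner ℂ ψ φ‖ ^ 2 : ℝ) : ℂ) := by
  rw [← sum_charFn_proj_mul_star]
  refine Finset.sum_subset (Finset.subset_univ _) fun u _ hu => ?_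
  rw [(card_stabilizerLabels h).2 u hu, star_zero, mul_zero]

/-! ### Attainment of the stabilizer fidelity -/

/-- The computational basis state `|0⟩` is stabilized by the group of all `w(p,0)`. -/
lemma exists_isStabilizerState (d n : ℕ) [NeZero d] : ∃ φ : Ket d n, IsStabilizerState φ := by
  let f : Multiplicative (Idx d n) →* Op d n :=
    { toFun := fun p => weyl p.toAdd 0
      map_one' := by simp [weyl_zero_right, chi_zero]
      map_mul' := fun p q => by
        simp [weyl_zero_right, add_dotProduct, chi_add] }
  have hf : Function.Injective f.toHomUnits := by
    intro p q hpq
    have h : weyl p.toAdd 0 = weyl q.toAdd 0 := congrArg Units.val hpq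
    apply Multiplicative.toAdd.injective
    ext1 i
    have hi := congrFun (congrFun h (Pi.single i 1)) (Pi.single i 1)
    simp only [weyl_zero_right, Matrix.diagonal_apply_eq, dotProduct_single, mul_one] at hi
    exact ZMod.injective_stdAddChar hi
  refine ⟨EuclideanSpace.single 0 1, by simp, f.toHomUnits.range, ?_, ?_, ?_, ?_⟩
  · rintro _ ⟨p, rfl⟩
    exact ⟨p.toAdd, 0, rfl⟩
  · rintro _ ⟨p, rfl⟩ _ ⟨q, rfl⟩
    rw [← map_mul, mul_comm, map_mul]
  · rw [← Nat.card_congr (MonoidHom.ofInjective hf).toEquiv]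
    simp [Nat.card_eq_fintype_card, ZMod.card]
  · rintro _ ⟨p, rfl⟩
    refine ⟨1, ?_⟩
    ext x
    change (weyl p.toAdd 0 *ᵥ _) x = _
    rw [weyl_zero_right, Matrix.mulVec_diagonal]
    by_cases hx : x = 0
    · simp [hx, chi_zero]
    · simp [hx]

lemma isCompact_setOf_isStabilizerState (d n : ℕ) [NeZero d] :
    IsCompact {φ : Ket d n | IsStabilizerState φ} := by
  let 𝒮 : Set (Subgroup (Op d n)ˣ) := {S |
    (∀ g ∈ S, ∃ p q : Fin n → ZMod d, (g : Op d n) = weyl p q) ∧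
    (∀ g ∈ S, ∀ h ∈ S, g * h = h * g) ∧ Nat.card S = d ^ n}
  have hfin : 𝒮.Finite := by
    have h1 : {g : (Op d n)ˣ | ∃ p q : Fin n → ZMod d, (g : Op d n) = weyl p q}.Finite := by
      have h2 := Set.finite_range fun u : Idx d n × Idx d n => weyl u.1 u.2
      refine (h2.preimage (f := Units.val) Units.val_injective.injOn).subset ?_
      rintro g ⟨p, q, h⟩
      exact ⟨(p, q), h.symm⟩
    refine (h1.finite_subsets.preimage (f := ((↑) : Subgroup (Op d n)ˣ → Set (Op d n)ˣ))
      SetLike.coe_injective.injOn).subset ?_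
    intro S hS g hg
    exact hS.1 g hg
  -- For a unit vector `φ`, being an eigenvector of `M` is the closed condition `Mφ = ⟨φ, Mφ⟩ φ`.
  have heq : {φ : Ket d n | IsStabilizerState φ} = ⋃ S ∈ 𝒮, Metric.sphere (0 : Ket d n) 1 ∩
      ⋂ g ∈ S, {φ | Matrix.toEuclideanLin (g : Op d n) φ =
        (inner ℂ φ (Matrix.toEuclideanLin (g : Op d n) φ) : ℂ) • φ} := by
    ext φ
    simp only [Set.mem_ofPred_eq, Set.mem_iUnion, Set.mem_inter_iff, Set.mem_iInter,
      mem_sphere_zero_iff_norm, exists_prop]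
    constructor
    · rintro ⟨hφ, S, h1, h2, h3, h4⟩
      refine ⟨S, ⟨h1, h2, h3⟩, hφ, fun g hg => ?_⟩
      obtain ⟨c, hc⟩ := h4 g hg
      have hc' : Matrix.toEuclideanLin (g : Op d n) φ = c • φ := WithLp.ofLp_injective _ hc
      rw [hc', inner_smul_right, inner_self_eq_norm_sq_to_K, hφ]
      simp
    · rintro ⟨S, ⟨h1, h2, h3⟩, hφ, h4⟩
      exact ⟨hφ, S, h1, h2, h3, fun g hg => ⟨_, congrArg WithLp.ofLp (h4 g hg)⟩⟩
  rw [heq]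
  refine hfin.isCompact_biUnion fun S _ => ?_
  refine (isCompact_sphere (0 : Ket d n) 1).inter_right ?_
  refine isClosed_iInter fun g => isClosed_iInter fun _ => ?_
  have hc : Continuous (Matrix.toEuclideanLin (g : Op d n)) :=
    LinearMap.continuous_of_finiteDimensional _
  have hin : Continuous fun φ : Ket d n =>
      (inner ℂ φ (Matrix.toEuclideanLin (g : Op d n) φ) : ℂ) :=
    continuous_id.inner hc
  exact isClosed_eq hc (hin.smul continuous_id)

lemma isGreatest_stabilizerFidelity (ψ : Ket d n) :
    IsGreatest (stabilizerOverlaps ψ) (stabilizerFidelity ψ) := by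
  have h : stabilizerOverlaps ψ =
      (fun φ : Ket d n => ‖(inner ℂ ψ φ : ℂ)‖ ^ 2) '' {φ | IsStabilizerState φ} := by
    ext F
    simp [stabilizerOverlaps, eq_comm]
  have hc : IsCompact (stabilizerOverlaps ψ) := by
    rw [h]
    exact (isCompact_setOf_isStabilizerState d n).image (by fun_prop)
  refine hc.isGreatest_sSup ?_
  rw [h]
  obtain ⟨φ, hφ⟩ := exists_isStabilizerState d n
  exact ⟨_, φ, hφ, rfl⟩

end Stabilizer

/-! ### Fourth moments of the characteristic function -/

section Bounds

variable {d n : ℕ} [NeZero d]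

lemma le_sum_norm_charFn {φ : Ket d n} (hφ : IsStabilizerState φ) (ψ : Ket d n) :
    (d : ℝ) ^ n * ‖inner ℂ ψ φ‖ ^ 2 ≤ ∑ u ∈ stabilizerLabels φ, ‖charFn (proj ψ) u‖ := by
  have h := congrArg norm (sum_stabilizerLabels hφ ψ)
  rw [Complex.norm_real, Real.norm_of_nonneg (by positivity)] at h
  rw [← h]
  refine (norm_sum_le _ _).trans (Finset.sum_le_sum fun u hu => ?_)
  rw [norm_mul, norm_star, norm_charFn_of_mem hφ.1 hu, mul_one]

/-- The power mean inequality, averaging over the labels of `φ`. -/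
lemma mul_pow_le_sum_norm_charFn_pow {φ : Ket d n} (hφ : IsStabilizerState φ) (ψ : Ket d n)
    (k : ℕ) :
    (d : ℝ) ^ n * (‖inner ℂ ψ φ‖ ^ 2) ^ (k + 1) ≤
      ∑ u ∈ stabilizerLabels φ, ‖charFn (proj ψ) u‖ ^ (k + 1) := by
  have hd : (0 : ℝ) < (d : ℝ) ^ n := pow_pos (Nat.cast_pos.mpr (NeZero.pos d)) _
  have h2 := pow_sum_le_card_mul_sum_pow (s := stabilizerLabels φ)
    (f := fun u => ‖charFn (proj ψ) u‖) (fun _ _ => norm_nonneg _) k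
  rw [(card_stabilizerLabels hφ).1, Nat.cast_pow] at h2
  have h3 := (pow_le_pow_left₀ (by positivity) (le_sum_norm_charFn hφ ψ) (k + 1)).trans h2
  rw [mul_pow, pow_succ ((d : ℝ) ^ n), mul_assoc] at h3
  exact le_of_mul_le_mul_left h3 (pow_pos hd k)

/-- Expansion of the characteristic function of `ψ` along `φ`; the vector `η` is the part of
`ψ` orthogonal to `φ`. -/
lemma exists_orthogonal_decomposition {φ ψ : Ket d n} (hφ : ‖φ‖ = 1) (hψ : ‖ψ‖ = 1) :
    ∃ η : Ket d n, inner ℂ φ η = 0 ∧ ‖η‖ ^ 2 = 1 - ‖inner ℂ ψ φ‖ ^ 2 ∧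
      ∀ u, charFn (proj ψ) u = ((‖inner ℂ ψ φ‖ ^ 2 : ℝ) : ℂ) * charFn (proj φ) u +
        inner ℂ ψ φ * inner ℂ φ (weylMap u.1 u.2 η) +
        inner ℂ φ ψ * inner ℂ η (weylMap u.1 u.2 φ) + charFn (proj η) u := by
  set a : ℂ := inner ℂ φ ψ with ha
  have hstar : (inner ℂ ψ φ : ℂ) = starRingEnd ℂ a := (inner_conj_symm _ _).symm
  have hna : ‖(inner ℂ ψ φ : ℂ)‖ = ‖a‖ := by rw [hstar, RCLike.norm_conj]
  have hφφ : (inner ℂ φ φ : ℂ) = 1 := by rw [inner_self_eq_norm_sq_to_K, hφ]; simp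
  obtain ⟨η, hη⟩ : ∃ η, ψ = a • φ + η := ⟨ψ - a • φ, by abel⟩
  have horth : inner ℂ φ η = (0 : ℂ) := by
    have h := ha
    rw [hη, inner_add_right, inner_smul_right, hφφ, mul_one] at h
    exact left_eq_add.mp h
  refine ⟨η, horth, ?_, fun u => ?_⟩
  · have h := norm_add_sq_eq_norm_sq_add_norm_sq_of_inner_eq_zero (𝕜 := ℂ) (a • φ) η
      (by rw [inner_smul_left, horth, mul_zero])
    rw [← hη, hψ, norm_smul, hφ] at h
    rw [hna]
    linarith
  · rw [hna, charFn_proj, charFn_proj, charFn_proj, hstar]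
    conv_lhs => rw [hη]
    simp only [map_add, map_smul, inner_add_left, inner_add_right, inner_smul_left,
      inner_smul_right]
    have h := Complex.conj_mul' a
    push_cast
    rw [← h]
    ring

/-- On the labels of `φ` the cross terms between `φ` and its orthogonal complement vanish. -/
lemma norm_charFn_mul_star_sub_le {φ ψ : Ket d n} (hφ : ‖φ‖ = 1) (hψ : ‖ψ‖ = 1)
    {u : Idx d n × Idx d n} (hu : u ∈ stabilizerLabels φ) :
    ‖charFn (proj ψ) u * star (charFn (proj φ) u) - ((‖inner ℂ ψ φ‖ ^ 2 : ℝ) : ℂ)‖ ≤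
      1 - ‖inner ℂ ψ φ‖ ^ 2 := by
  obtain ⟨η, horth, hη, hexp⟩ := exists_orthogonal_decomposition hφ hψ
  set c := charFn (proj φ) u with hc
  have hcn : ‖c‖ = 1 := norm_charFn_of_mem hφ hu
  have hcc : c * star c = 1 := by
    rw [Complex.star_def, Complex.mul_conj', hcn]
    simp
  have hW := weylMap_eq_charFn_smul hφ hu
  rw [← hc] at hW
  have h1 : inner ℂ η (weylMap u.1 u.2 φ) = (0 : ℂ) := by
    rw [hW, inner_smul_right, ← inner_conj_symm, horth, map_zero, mul_zero]
  have h2 : inner ℂ φ (weylMap u.1 u.2 η) = (0 : ℂ) := by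
    have h := inner_weylMap_weylMap u.1 u.2 φ η
    rw [hW, inner_smul_left, horth] at h
    refine (mul_eq_zero.mp h).resolve_left fun h0 => ?_
    rw [map_eq_zero] at h0
    simp [h0] at hcn
  rw [hexp u, h1, h2, ← hη]
  have h3 : (((‖inner ℂ ψ φ‖ ^ 2 : ℝ) : ℂ) * c + inner ℂ ψ φ * 0 + inner ℂ φ ψ * 0 +
      charFn (proj η) u) * star c - ((‖inner ℂ ψ φ‖ ^ 2 : ℝ) : ℂ) =
      charFn (proj η) u * star c := by
    linear_combination ((‖inner ℂ ψ φ‖ ^ 2 : ℝ) : ℂ) * hcc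
  rw [h3, norm_mul, norm_star, hcn, mul_one]
  exact norm_charFn_proj_le η u

lemma norm_charFn_sq_le {φ ψ : Ket d n} (hφ : IsStabilizerState φ) (hψ : ‖ψ‖ = 1)
    {u : Idx d n × Idx d n} (hu : u ∉ stabilizerLabels φ) :
    ‖charFn (proj ψ) u‖ ^ 2 ≤ 9 * (1 - ‖inner ℂ ψ φ‖ ^ 2) := by
  obtain ⟨η, -, hη, hexp⟩ := exists_orthogonal_decomposition hφ.1 hψ
  have ha : ‖(inner ℂ ψ φ : ℂ)‖ ≤ 1 := by
    simpa [hφ.1, hψ] using norm_inner_le_norm (𝕜 := ℂ) ψ φ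
  have ha' : ‖(inner ℂ φ ψ : ℂ)‖ ≤ 1 := by
    simpa [hφ.1, hψ] using norm_inner_le_norm (𝕜 := ℂ) φ ψ
  have h1 : ‖(inner ℂ φ (weylMap u.1 u.2 η) : ℂ)‖ ≤ ‖η‖ := by
    simpa [hφ.1, norm_weylMap] using norm_inner_le_norm (𝕜 := ℂ) φ (weylMap u.1 u.2 η)
  have h2 : ‖(inner ℂ η (weylMap u.1 u.2 φ) : ℂ)‖ ≤ ‖η‖ := by
    simpa [hφ.1, norm_weylMap] using norm_inner_le_norm (𝕜 := ℂ) η (weylMap u.1 u.2 φ)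
  have h3 : ‖charFn (proj η) u‖ ≤ ‖η‖ := by
    refine (norm_charFn_proj_le η u).trans ?_
    have : ‖η‖ ≤ 1 := by nlinarith [sq_nonneg ‖(inner ℂ ψ φ : ℂ)‖]
    nlinarith [norm_nonneg η]
  have h4 : ‖charFn (proj ψ) u‖ ≤ 3 * ‖η‖ := by
    rw [hexp u, (card_stabilizerLabels hφ).2 u hu, mul_zero, zero_add]
    refine (norm_add₃_le).trans ?_
    rw [norm_mul, norm_mul]
    have := mul_le_mul ha h1 (norm_nonneg _) zero_le_one
    have := mul_le_mul ha' h2 (norm_nonneg _) zero_le_one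
    linarith
  rw [← hη]
  calc ‖charFn (proj ψ) u‖ ^ 2 ≤ (3 * ‖η‖) ^ 2 := by gcongr
    _ = 9 * ‖η‖ ^ 2 := by ring

/-- Second-order expansion of `|F + g|⁴` around a real number `F`. -/
lemma norm_add_pow_four_le {F : ℝ} {g : ℂ} (hF₀ : 0 ≤ F) (hg : ‖g‖ ≤ 1 - F) :
    ‖(F : ℂ) + g‖ ^ 4 ≤ F ^ 4 + 4 * F ^ 3 * g.re + 11 * (1 - F) ^ 2 := by
  have hF₁ : F ≤ 1 := by linarith [norm_nonneg g]
  have h1 : ‖(F : ℂ) + g‖ ^ 2 = F ^ 2 + 2 * F * g.re + ‖g‖ ^ 2 := by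
    rw [Complex.sq_norm, Complex.sq_norm, Complex.normSq_apply, Complex.normSq_apply]
    simp
    ring
  have hr : |g.re| ≤ ‖g‖ := Complex.abs_re_le_norm g
  have hg1 : ‖g‖ ≤ 1 := by linarith
  have hs : ‖g‖ ^ 2 ≤ (1 - F) ^ 2 := by gcongr
  have hs0 := sq_nonneg ‖g‖
  have hs1 : ‖g‖ ^ 2 ≤ 1 := pow_le_one₀ (norm_nonneg _) hg1
  have hr2 : g.re ^ 2 ≤ ‖g‖ ^ 2 :=
    sq_le_sq' (by linarith [neg_abs_le g.re]) ((le_abs_self _).trans hr)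
  have hr1 : g.re ≤ 1 := (le_abs_self _).trans (hr.trans hg1)
  have hF2 : F ^ 2 ≤ 1 := pow_le_one₀ hF₀ hF₁
  have e1 : F ^ 2 * g.re ^ 2 ≤ ‖g‖ ^ 2 := by nlinarith [sq_nonneg g.re]
  have e2 : F ^ 2 * ‖g‖ ^ 2 ≤ ‖g‖ ^ 2 := by nlinarith
  have e3 : F * g.re * ‖g‖ ^ 2 ≤ ‖g‖ ^ 2 := by
    have : F * g.re ≤ 1 := by nlinarith
    nlinarith
  have e4 : ‖g‖ ^ 2 * ‖g‖ ^ 2 ≤ ‖g‖ ^ 2 := by nlinarith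
  calc ‖(F : ℂ) + g‖ ^ 4 = (F ^ 2 + 2 * F * g.re + ‖g‖ ^ 2) ^ 2 := by rw [← h1]; ring
    _ = F ^ 4 + 4 * F ^ 3 * g.re + (4 * (F ^ 2 * g.re ^ 2) + 2 * (F ^ 2 * ‖g‖ ^ 2) +
        4 * (F * g.re * ‖g‖ ^ 2) + ‖g‖ ^ 2 * ‖g‖ ^ 2) := by ring
    _ ≤ _ := by linarith

lemma sum_norm_charFn_pow_four_le {φ ψ : Ket d n} (hφ : IsStabilizerState φ) (hψ : ‖ψ‖ = 1) :
    ∑ u, ‖charFn (proj ψ) u‖ ^ 4 ≤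
      (d : ℝ) ^ n * ((‖inner ℂ ψ φ‖ ^ 2) ^ 4 + 29 * (1 - ‖inner ℂ ψ φ‖ ^ 2) ^ 2) := by
  have hd : (0 : ℝ) < (d : ℝ) ^ n := pow_pos (Nat.cast_pos.mpr (NeZero.pos d)) _
  set F := ‖(inner ℂ ψ φ : ℂ)‖ ^ 2 with hF
  set L := stabilizerLabels φ with hL
  have hcard : (L.card : ℝ) = (d : ℝ) ^ n := by rw [(card_stabilizerLabels hφ).1]; push_cast; rfl
  have hF₀ : 0 ≤ F := by positivity
  have hF₁ : F ≤ 1 := by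
    have : ‖(inner ℂ ψ φ : ℂ)‖ ≤ 1 := by
      simpa [hφ.1, hψ] using norm_inner_le_norm (𝕜 := ℂ) ψ φ
    exact pow_le_one₀ (norm_nonneg _) this
  -- On the labels of `φ`, `g` has mean zero, so that the linear term averages out.
  have hon : ∑ u ∈ L, ‖charFn (proj ψ) u‖ ^ 4 ≤ (d : ℝ) ^ n * (F ^ 4 + 11 * (1 - F) ^ 2) := by
    let g : Idx d n × Idx d n → ℂ := fun u =>
      charFn (proj ψ) u * star (charFn (proj φ) u) - (F : ℂ)
    have hg : ∑ u ∈ L, (g u).re = 0 := by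
      rw [← Complex.re_sum, Finset.sum_sub_distrib, sum_stabilizerLabels hφ ψ, Finset.sum_const,
        nsmul_eq_mul, ← Complex.ofReal_natCast, hcard, ← Complex.ofReal_mul, sub_self,
        Complex.zero_re]
    have hb : ∀ u ∈ L, ‖charFn (proj ψ) u‖ ^ 4 ≤
        F ^ 4 + 4 * F ^ 3 * (g u).re + 11 * (1 - F) ^ 2 := by
      intro u hu
      have h := norm_add_pow_four_le hF₀ (norm_charFn_mul_star_sub_le hφ.1 hψ hu)
      rwa [add_sub_cancel, norm_mul, norm_star, norm_charFn_of_mem hφ.1 hu, mul_one] at h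
    refine (Finset.sum_le_sum hb).trans_eq ?_
    rw [Finset.sum_add_distrib, Finset.sum_add_distrib, ← Finset.mul_sum, hg, Finset.sum_const,
      Finset.sum_const, nsmul_eq_mul, nsmul_eq_mul, hcard]
    ring
  -- Off the labels of `φ`, both the values and the total weight are of first order in `1 - F`.
  have hoff : ∑ u ∈ Lᶜ, ‖charFn (proj ψ) u‖ ^ 4 ≤ (d : ℝ) ^ n * (18 * (1 - F) ^ 2) := by
    have hmass : ∑ u ∈ Lᶜ, ‖charFn (proj ψ) u‖ ^ 2 ≤ (d : ℝ) ^ n * (2 * (1 - F)) := by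
      have h1 := sum_norm_charFn_sq hψ
      rw [← Finset.sum_add_sum_compl L] at h1
      have h2 := mul_pow_le_sum_norm_charFn_pow hφ ψ 1
      rw [← hF, ← hL] at h2
      have h3 : (d : ℝ) ^ n * (1 - F ^ 2) ≤ (d : ℝ) ^ n * (2 * (1 - F)) := by
        gcongr
        nlinarith [sq_nonneg (1 - F)]
      norm_num at h2
      linarith
    calc ∑ u ∈ Lᶜ, ‖charFn (proj ψ) u‖ ^ 4
        ≤ ∑ u ∈ Lᶜ, 9 * (1 - F) * ‖charFn (proj ψ) u‖ ^ 2 := by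
          refine Finset.sum_le_sum fun u hu => ?_
          have h := norm_charFn_sq_le hφ hψ (Finset.mem_compl.mp hu)
          calc ‖charFn (proj ψ) u‖ ^ 4 =
                ‖charFn (proj ψ) u‖ ^ 2 * ‖charFn (proj ψ) u‖ ^ 2 := by ring
            _ ≤ _ := by gcongr
      _ = 9 * (1 - F) * ∑ u ∈ Lᶜ, ‖charFn (proj ψ) u‖ ^ 2 := by rw [Finset.mul_sum]
      _ ≤ 9 * (1 - F) * ((d : ℝ) ^ n * (2 * (1 - F))) := by
          have : 0 ≤ 1 - F := by linarith
          gcongr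
      _ = _ := by ring
  rw [← Finset.sum_add_sum_compl L]
  linarith

end Bounds

end StabTest

theorem mainTheorem3 :
    ∃ C : ℝ, ∀ (d : ℕ) [Fact d.Prime], Odd d → ∀ (n : ℕ) (ψ : StabTest.Ket d n), ‖ψ‖ = 1 →
      IsGreatest (StabTest.stabilizerOverlaps ψ) (StabTest.stabilizerFidelity ψ) ∧
      ((StabTest.acceptProb ψ : ℝ) : ℂ) =
        1 / 2 * (1 + Matrix.trace
          (StabTest.hadamardConv (StabTest.proj ψ) (StabTest.proj ψ) ^ 2)) ∧
      ∀ ε : ℝ, StabTest.stabilizerFidelity ψ = 1 - ε →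
        1 / 2 * (1 + (1 - ε) ^ 4) ≤ StabTest.acceptProb ψ ∧
        StabTest.acceptProb ψ ≤ 1 - 2 * ε + C * ε ^ 2 := by
  refine ⟨18, fun d _ hd n ψ hψ => ⟨StabTest.isGreatest_stabilizerFidelity ψ, ?_, ?_⟩⟩
  · rw [StabTest.acceptProb_eq hd hψ, StabTest.trace_hadamardConv_sq hd]
    push_cast
    ring
  · intro ε hε
    obtain ⟨φ, hφ, hF⟩ := (StabTest.isGreatest_stabilizerFidelity ψ).1
    rw [hε] at hF
    have hdn : (0 : ℝ) < (d : ℝ) ^ n := pow_pos (Nat.cast_pos.mpr (NeZero.pos d)) _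
    have hlow := (StabTest.mul_pow_le_sum_norm_charFn_pow hφ ψ 3).trans
      (Finset.sum_le_univ_sum_of_nonneg fun _ => by positivity)
    have hup := StabTest.sum_norm_charFn_pow_four_le hφ hψ
    have hε₀ : 0 ≤ ε ∧ ε ≤ 1 := by
      have h0 : 0 ≤ ‖(inner ℂ ψ φ : ℂ)‖ ^ 2 := by positivity
      have h1 : ‖(inner ℂ ψ φ : ℂ)‖ ≤ 1 := by
        simpa [hφ.1, hψ] using norm_inner_le_norm (𝕜 := ℂ) ψ φ
      have h2 := pow_le_one₀ (n := 2) (norm_nonneg _) h1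
      constructor <;> linarith
    rw [← hF] at hlow hup
    rw [StabTest.acceptProb_eq hd hψ]
    rw [← le_inv_mul_iff₀ hdn] at hlow
    rw [← inv_mul_le_iff₀ hdn] at hup
    norm_num at hlow
    refine ⟨by linarith, ?_⟩
    have hexp : (1 - ε) ^ 4 ≤ 1 - 4 * ε + 6 * ε ^ 2 := by
      have : 0 ≤ ε ^ 3 * (4 - ε) := mul_nonneg (pow_nonneg hε₀.1 3) (by linarith [hε₀.2])
      linarith
    have hs : (1 - (1 - ε)) ^ 2 = ε ^ 2 := by ring
    rw [hs] at hup
    linarith [sq_nonneg ε]
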